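/- Consider networks given by a connected undirected graph with $n\ge 1$ nodes, in which the nodes have pairwise distinct identifiers and the edges have (not necessarily distinct) weights; identifiers and weights are integers in $[1,p(n)]$ for a polynomial $p$, and every weight is encoded on $s\ge 1$ bits (i.e. is smaller than $2^s$). Computation takes place in the state model: the local view of a node consists of its identifier, its own state, and the weights of its adjacent edges together with the states of the corresponding neighbours; an algorithm is a set of rules saying to which new states a node with a given local view may change; a node is enabled if some rule applies to it. In each step, the distributed unfair scheduler activates an arbitrary nonempty set of enabled nodes, which apply a rule simultaneously. The first round of an execution is its minimal prefix such that every node enabled at its beginning has been activated or has ceased to be enabled; the second round is the first round of the remaining execution, and so on. The output of a node is a pointer (the identifier of another node, or nothing) that is read off its state. There is a (not necessarily self-stabilizing) distributed algorithm, the same for all networks and without knowledge of $n$, $p$ or $s$, that builds a minimum spanning tree in space $O(s+\log n)$ and in polynomial time. That is, for every polynomial $p$ there are a constant $C$ and a polynomial $q$ such that on every network as above, every execution that starts from the clean configuration (all nodes in the same fixed empty state), whatever the choices of the scheduler, 1. is finite, i.e. reaches a configuration in which no node is enabled if it is continued for as long as possible; 2. uses at most $C\,(s+\log_2 n)$ bits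 at each node, in each of its configurations, to encode the node's state; 3. contains at most $q(n)$ complete rounds; and 4. if it ends in a configuration in which no node is enabled, then the edges $\{u,v\}$ such that $u$ points to $v$ or $v$ points to $u$ form a minimum spanning tree of the network. -/

import Mathlib

open Polynomial

/-- A network on the set `V` of nodes: a connected undirected graph, pairwise distinct
identifiers of the nodes, and weights of the edges (`weight e` is only ever used when `e` is an
edge of `graph`; distinct edges may have equal weights). -/
structure Network (V : Type*) where
  graph : SimpleGraph V
  connected : graph.Connected
  ident : V → ℕ
  ident_injective : Function.Injective ident
  weight : Sym2 V → ℕ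

/-- The local view of a node: its identifier, its own state, and, for each adjacent edge, the
weight of the edge together with the state of the neighbour at its other end.  The view is
anonymous: a node recognises a neighbour only by what that neighbour has written in its state. -/
structure LocalView (σ : Type) where
  ident : ℕ
  own : σ
  nbrs : Multiset (ℕ × σ)

/-- A distributed algorithm in the state model.  One and the same algorithm is run by every node of
every network; it is given neither the number of nodes nor any bound on weights or identifiers.

* `State` is the set of states (the mutable memory of a node), and `encode` writes each state as a
  string of bits; the space used by a state is the length of this string.
* `clean` is the state of a node whose variables are all empty.
* `rule x q` says that a node with local view `x` may change its state to `q`.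
* `pointer q` is the output of a node in state `q`: the identifier of the node that it points to,
  or `none`. -/
structure DistAlgorithm where
  State : Type
  encode : State → List Bool
  encode_injective : Function.Injective encode
  clean : State
  rule : LocalView State → State → Prop
  pointer : State → Option ℕ

namespace DistAlgorithm

variable {V : Type*}

/-- A configuration: the states of all nodes. -/
abbrev Config (A : DistAlgorithm) (V : Type*) := V → A.State

/-- The configuration in which every node is in the clean state. -/
def cleanConfig (A : DistAlgorithm) (V : Type*) : A.Config V := fun _ => A.clean

open Classical in
/-- The local view of the node `v` in the configuration `γ`. -/
noncomputable def view [Fintype V] (A : DistAlgorithm) (N : Network V) (γ : A.Config V) (v : V) :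
    LocalView A.State where
  ident := N.ident v
  own := γ v
  nbrs := (N.graph.neighborFinset v).val.map fun u => (N.weight s(v, u), γ u)

/-- The set of enabled nodes in the configuration `γ`. -/
def enabled [Fintype V] (A : DistAlgorithm) (N : Network V) (γ : A.Config V) : Set V :=
  {v | ∃ q, A.rule (A.view N γ v) q}

/-- A configuration is terminal if no node is enabled. -/
def Terminal [Fintype V] (A : DistAlgorithm) (N : Network V) (γ : A.Config V) : Prop :=
  A.enabled N γ = ∅

/-- One step under the distributed unfair scheduler: the scheduler activates an arbitrary nonempty
set `S` of enabled nodes; each of them reads its view in `γ` and applies a rule, simultaneously,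
and this results in `γ'`. -/
def Step [Fintype V] (A : DistAlgorithm) (N : Network V) (γ : A.Config V) (S : Set V)
    (γ' : A.Config V) : Prop :=
  S.Nonempty ∧ S ⊆ A.enabled N γ ∧ (∀ v ∈ S, A.rule (A.view N γ v) (γ' v)) ∧ ∀ v ∉ S, γ' v = γ v

/-- The nodes that the current round still waits for after a step that activates the nodes in `S`
and leads to `γ'`, if it waited for the nodes in `P` before that step: those that have not been
activated and are still enabled. -/
def stillPending [Fintype V] (A : DistAlgorithm) (N : Network V) (P S : Set V) (γ' : A.Config V) :
    Set V :=
  {v ∈ P | v ∉ S ∧ v ∈ A.enabled N γ'}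

/-- `A.Run N r P γ`: there is a (finite) execution from the clean configuration that ends in `γ`,
in which exactly `r` rounds have been completed, and `P` is the set of nodes that the current round
still waits for.

The first round of an execution is its minimal prefix such that every node that was enabled in its
initial configuration has been activated or has ceased to be enabled; the second round is the first
round of the remaining execution, and so on. -/
inductive Run [Fintype V] (A : DistAlgorithm) (N : Network V) : ℕ → Set V → A.Config V → Prop
  | start : Run A N 0 (A.enabled N (A.cleanConfig V)) (A.cleanConfig V)
  | sameRound {r : ℕ} {P S : Set V} {γ γ' : A.Config V} :
      Run A N r P γ → A.Step N γ S γ' → (A.stillPending N P S γ').Nonempty →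
      Run A N r (A.stillPending N P S γ') γ'
  | endRound {r : ℕ} {P S : Set V} {γ γ' : A.Config V} :
      Run A N r P γ → A.Step N γ S γ' → A.stillPending N P S γ' = ∅ →
      Run A N (r + 1) (A.enabled N γ') γ'

/-- Every execution from the clean configuration is finite. -/
def AlwaysTerminates [Fintype V] (A : DistAlgorithm) (N : Network V) : Prop :=
  ¬ ∃ γ : ℕ → A.Config V, γ 0 = A.cleanConfig V ∧ ∀ i, ∃ S, A.Step N (γ i) S (γ (i + 1))

/-- The graph formed by the output of the configuration `γ`: the edges `{u, v}` such that one of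
the distinct nodes `u`, `v` points to the other one. -/
def outputGraph (A : DistAlgorithm) (N : Network V) (γ : A.Config V) : SimpleGraph V :=
  SimpleGraph.fromRel fun u v => A.pointer (γ u) = some (N.ident v)

end DistAlgorithm

namespace Network

variable {V : Type*}

/-- `T` is a spanning tree of the network. -/
def IsSpanningTree (N : Network V) (T : SimpleGraph V) : Prop :=
  T ≤ N.graph ∧ T.IsTree

open Classical in
/-- The total weight of the edges of `T`. -/
noncomputable def totalWeight [Fintype V] (N : Network V) (T : SimpleGraph V) : ℕ :=
  ∑ e ∈ T.edgeFinset, N.weight e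

/-- `T` is a minimum spanning tree of the network. -/
def IsMST [Fintype V] (N : Network V) (T : SimpleGraph V) : Prop :=
  N.IsSpanningTree T ∧ ∀ T', N.IsSpanningTree T' → N.totalWeight T ≤ N.totalWeight T'

end Network

/-!
The algorithm is Prim's algorithm in a synchronous setting, run through a synchronizer.

*Synchronizer.* Each node carries a clock that counts its steps, and keeps its two most recent
states.  A node moves only when no neighbour is behind it, so that the clocks of neighbours differ
by at most one and a node always finds the states it needs among those that its neighbours show.
Hence whatever the scheduler does, a node with clock `t` is in its state at time `t` of the
(deterministic) synchronous execution.  If the latter stops at time `T`, then every execution makes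
at most `n * T` steps, and in every round the smallest clock advances, so that there are at most `T`
rounds (`SyncAlgorithm.alwaysTerminates`, `SyncAlgorithm.roundInvariant_of_run`).

*Finding a bound on the number of nodes.* The nodes flood the largest identifier `M`, which
satisfies `n ≤ M ≤ p(n)` because identifiers are distinct and positive.  At time `t` a node has
heard of all identifiers at distance less than `t`.  If these do not include all nodes, then they
include at least `t` distinct positive integers, so that the largest of them is at least `t`.
Conversely, as soon as the time exceeds the largest identifier heard of, this identifier is `M`; and
this happens at time `M + 1` at all nodes at once (`Network.leader_eq_of_lt`).  So all nodes agree,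
without further communication, on the beginning of phases of length `M + 1`.

*Prim's algorithm.* The node with identifier `M` is the root.  In each phase the nodes flood the
least name (weight and identifiers of the ends) of an edge leaving the tree; a phase is longer than
any path, so that at its end all nodes know this name (`Network.best_phase_end`).  The outer end of
this edge joins the tree by pointing to the inner end.  By the cut property
(`Network.IsMST.exists_exchange`) the tree remains part of a minimum spanning tree, and by time
`(M + 1) ^ 2`, when all nodes stop, it spans the network (`Network.isMST_primExec`).

A state consists of a bounded number of integers, each of which is either a weight or at most
`(p(n) + 1) ^ 2`; this gives the bound on the space.
-/

/-! ### Minimum spanning trees and Prim's algorithm -/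

namespace Network

variable {V : Type*}

theorem exists_isMST [Fintype V] (N : Network V) : ∃ T, N.IsMST T := by
  classical
  obtain ⟨T₀, hle, hT₀⟩ := N.connected.exists_isTree_le
  obtain ⟨T, hT, hmin⟩ := Set.exists_min_image {T | N.IsSpanningTree T} N.totalWeight
    (Set.toFinite _) ⟨T₀, hle, hT₀⟩
  exact ⟨T, hT, hmin⟩

/-- The cut property of minimum spanning trees, in the form of an exchange step: a lightest edge
leaving a set `S` can be added to any part of a minimum spanning tree that does not leave `S`. -/
theorem IsMST.exists_exchange [Fintype V] {N : Network V} {T F : SimpleGraph V} (hT : N.IsMST T)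
    (hF : F ≤ T) {S : Set V} (hFS : ∀ x y, F.Adj x y → x ∈ S → y ∈ S) {a b : V}
    (ha : a ∈ S) (hb : b ∉ S) (hab : N.graph.Adj a b)
    (hmin : ∀ x ∈ S, ∀ y ∉ S, N.graph.Adj x y → N.weight s(a, b) ≤ N.weight s(x, y)) :
    ∃ T', N.IsMST T' ∧ F ≤ T' ∧ T'.Adj a b := by
  classical
  by_cases he : T.Adj a b
  · exact ⟨T, hT, hF, he⟩
  obtain ⟨⟨hTN, hTt⟩, hTmin⟩ := hT
  have hne : a ≠ b := hab.ne
  obtain ⟨p, hp⟩ := hTt.connected.exists_isPath a b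
  -- the path of `T` between the ends of the new edge leaves `S` by an edge `f`
  obtain ⟨d, hd, hdS, hdS'⟩ := p.exists_boundary_dart S ha hb
  obtain ⟨⟨x, y⟩, hxy⟩ := d
  simp only at hdS hdS'
  have hfp : s(x, y) ∈ p.edges := List.mem_map_of_mem (f := SimpleGraph.Dart.edge) hd
  have hfe : s(x, y) ≠ s(a, b) := fun h => he (by
    rw [← SimpleGraph.mem_edgeSet, ← h]; exact hxy)
  -- the new edge closes a cycle through `f`, so that `f` can be removed
  set G := T ⊔ SimpleGraph.edge a b with hG
  have hGba : G.Adj b a := by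
    rw [hG, SimpleGraph.sup_adj, SimpleGraph.edge_adj]; exact Or.inr ⟨Or.inr ⟨rfl, rfl⟩, hne.symm⟩
  have hcyc : (SimpleGraph.Walk.cons hGba (p.mapLe (le_sup_left : T ≤ G))).IsCycle := by
    rw [SimpleGraph.Walk.cons_isCycle_iff]
    refine ⟨hp.mapLe _, ?_⟩
    rw [SimpleGraph.Walk.edges_mapLe_eq_edges]
    intro h
    exact he (p.adj_of_mem_edges h).symm
  have hGc : G.Connected := hTt.connected.mono le_sup_left
  have hnb : ¬ G.IsBridge s(x, y) := fun h =>
    (SimpleGraph.isBridge_iff_forall_cycle_notMem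
      (le_sup_left (a := T) (b := SimpleGraph.edge a b) hxy)).1 h _ hcyc (by
        rw [SimpleGraph.Walk.edges_cons, SimpleGraph.Walk.edges_mapLe_eq_edges]
        exact List.mem_cons_of_mem _ hfp)
  set T' := G.deleteEdges {s(x, y)} with hT'
  have hT'c : T'.Connected := hGc.connected_delete_edge_of_not_isBridge hnb
  have hedge : T'.edgeFinset = insert s(a, b) (T.edgeFinset.erase s(x, y)) := by
    ext e
    simp only [SimpleGraph.mem_edgeFinset, hT', SimpleGraph.edgeSet_deleteEdges, hG,
      SimpleGraph.edgeSet_sup, SimpleGraph.edgeSet_edge_of_ne hne, Finset.mem_insert,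
      Finset.mem_erase, Set.mem_sdiff, Set.mem_union, Set.mem_singleton_iff]
    constructor
    · rintro ⟨h | h, h'⟩
      · exact Or.inr ⟨h', h⟩
      · exact Or.inl h
    · rintro (h | ⟨h', h⟩)
      · exact ⟨Or.inr h, by rw [h]; exact hfe.symm⟩
      · exact ⟨Or.inl h, h'⟩
  have hmemf : s(x, y) ∈ T.edgeFinset := SimpleGraph.mem_edgeFinset.2 hxy
  have hnot : s(a, b) ∉ T.edgeFinset.erase s(x, y) := fun h =>
    he (SimpleGraph.mem_edgeFinset.1 (Finset.mem_of_mem_erase h))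
  have hT't : T'.IsTree := by
    rw [SimpleGraph.isTree_iff_connected_and_card] at hTt ⊢
    refine ⟨hT'c, ?_⟩
    rw [← hTt.2, Nat.card_eq_fintype_card, Nat.card_eq_fintype_card,
      ← SimpleGraph.edgeFinset_card, ← SimpleGraph.edgeFinset_card, hedge,
      Finset.card_insert_of_notMem hnot, Finset.card_erase_add_one hmemf]
  have hT'N : T' ≤ N.graph := (SimpleGraph.deleteEdges_le _).trans
    (sup_le hTN ((SimpleGraph.edge_le_iff _).2 (Or.inr hab)))
  have hw : N.totalWeight T' ≤ N.totalWeight T := by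
    unfold totalWeight
    have h1 : ∑ e ∈ T'.edgeFinset, N.weight e ≤ ∑ e ∈ T.edgeFinset, N.weight e := by
      rw [hedge, Finset.sum_insert hnot, ← Finset.add_sum_erase _ _ hmemf]
      exact Nat.add_le_add_right (hmin x hdS y hdS' (hTN hxy)) _
    convert h1
  refine ⟨T', ⟨⟨hT'N, hT't⟩, fun T'' h => hw.trans (hTmin T'' h)⟩, ?_, ?_⟩
  · intro u v huv
    rw [hT', SimpleGraph.deleteEdges_adj]
    refine ⟨Or.inl (hF huv), fun h => ?_⟩
    rw [Set.mem_singleton_iff] at h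
    rcases Sym2.eq_iff.1 h with ⟨rfl, rfl⟩ | ⟨rfl, rfl⟩
    · exact hdS' (hFS _ _ huv hdS)
    · exact hdS' (hFS _ _ huv.symm hdS)
  · rw [← SimpleGraph.mem_edgeSet, ← SimpleGraph.mem_edgeFinset, hedge]
    exact Finset.mem_insert_self _ _

/-- The graph formed by the pointers `P`. -/
def pointerGraph (N : Network V) (P : V → Option ℕ) : SimpleGraph V :=
  SimpleGraph.fromRel fun u v => P u = some (N.ident v)

/-- The nodes of the tree grown from the node `r`: `r` itself and the nodes that have a pointer. -/
def reached (r : V) (P : V → Option ℕ) : Set V := {v | v = r ∨ P v ≠ none}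

/-- The invariant of Prim's algorithm: the pointers lead to reached nodes, they connect all
reached nodes to the root, and they are part of some minimum spanning tree. -/
structure PrimInvariant [Fintype V] (N : Network V) (r : V) (P : V → Option ℕ) : Prop where
  pointer_reached : ∀ v a, P v = some a → ∃ u ∈ reached r P, N.ident u = a
  reachable : ∀ v ∈ reached r P, (N.pointerGraph P).Reachable v r
  le_isMST : ∃ T, N.IsMST T ∧ N.pointerGraph P ≤ T

theorem primInvariant_none [Fintype V] (N : Network V) (r : V) :
    N.PrimInvariant r fun _ => none where
  pointer_reached v a h := by simp at h
  reachable v h := by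
    obtain rfl : v = r := by simpa [reached] using h
    rfl
  le_isMST := by
    obtain ⟨T, hT⟩ := N.exists_isMST
    refine ⟨T, hT, fun u v h => ?_⟩
    simp [pointerGraph] at h

open Classical in
/-- Prim's step: a lightest edge leaving the tree is added. -/
theorem PrimInvariant.update [Fintype V] {N : Network V} {r : V} {P : V → Option ℕ}
    (h : N.PrimInvariant r P) {u v : V} (hu : u ∈ reached r P) (hv : v ∉ reached r P)
    (huv : N.graph.Adj u v)
    (hmin : ∀ x ∈ reached r P, ∀ y ∉ reached r P, N.graph.Adj x y →
      N.weight s(u, v) ≤ N.weight s(x, y)) :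
    N.PrimInvariant r (Function.update P v (some (N.ident u))) := by
  set P' := Function.update P v (some (N.ident u)) with hP'
  have hPv : P v = none := by
    by_contra h'
    exact hv (Or.inr h')
  have hreach : reached r P' = insert v (reached r P) := by
    ext x
    by_cases hx : x = v
    · simp [reached, hP', hx]
    · simp [reached, hP', hx]
  have hle : N.pointerGraph P ≤ N.pointerGraph P' := by
    intro x y hxy
    simp only [pointerGraph, SimpleGraph.fromRel_adj] at hxy ⊢
    refine ⟨hxy.1, hxy.2.imp (fun h' => ?_) (fun h' => ?_)⟩
    all_goals
      rw [hP', Function.update_of_ne]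
      · exact h'
      · rintro rfl
        simp [hPv] at h'
  have hadj : (N.pointerGraph P').Adj v u := by
    simp only [pointerGraph, SimpleGraph.fromRel_adj]
    exact ⟨huv.ne', Or.inl (by simp [hP'])⟩
  refine ⟨?_, ?_, ?_⟩
  · intro x a hx
    rw [hreach]
    by_cases hxv : x = v
    · subst hxv
      exact ⟨u, Or.inr hu, by simpa [hP'] using hx⟩
    · obtain ⟨y, hy, hya⟩ := h.pointer_reached x a (by simpa [hP', hxv] using hx)
      exact ⟨y, Or.inr hy, hya⟩
  · rw [hreach]
    rintro x (rfl | hx)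
    · exact hadj.reachable.trans ((h.reachable u hu).mono hle)
    · exact (h.reachable x hx).mono hle
  · obtain ⟨T, hT, hTP⟩ := h.le_isMST
    have hin : ∀ x y, (N.pointerGraph P).Adj x y → x ∈ reached r P → y ∈ reached r P := by
      intro x y hxy _
      simp only [pointerGraph, SimpleGraph.fromRel_adj] at hxy
      rcases hxy.2 with h' | h'
      · obtain ⟨z, hz, hzy⟩ := h.pointer_reached _ _ h'
        rwa [← N.ident_injective hzy]
      · exact Or.inr (by simp [h'])
    obtain ⟨T', hT', hPT', huvT'⟩ := hT.exists_exchange hTP hin hu hv huv hmin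
    refine ⟨T', hT', fun x y hxy => ?_⟩
    simp only [pointerGraph, SimpleGraph.fromRel_adj] at hxy
    have key : ∀ x y, x ≠ y → P' x = some (N.ident y) → T'.Adj x y := by
      intro x y hne hx
      by_cases hxv : x = v
      · subst hxv
        obtain rfl : u = y := N.ident_injective (by simpa [hP'] using hx)
        exact huvT'.symm
      · refine hPT' ?_
        simp only [pointerGraph, SimpleGraph.fromRel_adj]
        exact ⟨hne, Or.inl (by simpa [hP', hxv] using hx)⟩
    rcases hxy.2 with h' | h'
    · exact key x y hxy.1 h'
    · exact (key y x hxy.1.symm h').symm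

theorem PrimInvariant.isMST [Fintype V] {N : Network V} {r : V} {P : V → Option ℕ}
    (h : N.PrimInvariant r P) (hall : reached r P = Set.univ) : N.IsMST (N.pointerGraph P) := by
  obtain ⟨T, hT, hle⟩ := h.le_isMST
  have hc : (N.pointerGraph P).Connected := by
    refine @SimpleGraph.Connected.mk _ _ (fun x y => ?_) ⟨r⟩
    exact (h.reachable x (hall ▸ trivial)).trans (h.reachable y (hall ▸ trivial)).symm
  -- a tree has no proper connected spanning subgraph
  have heq : N.pointerGraph P = T := le_antisymm hle
    ((SimpleGraph.isTree_iff_minimal_connected.1 hT.1.2).2 hc hle)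
  rwa [heq]

theorem exists_adj_of_reached_ne_univ (N : Network V) {r : V} {P : V → Option ℕ}
    (h : reached r P ≠ Set.univ) :
    ∃ u ∈ reached r P, ∃ v ∉ reached r P, N.graph.Adj u v := by
  obtain ⟨v, hv⟩ := (Set.ne_univ_iff_exists_notMem _).1 h
  obtain ⟨p⟩ := N.connected.preconnected r v
  obtain ⟨d, -, h1, h2⟩ := p.exists_boundary_dart (reached r P) (Or.inl rfl) hv
  exact ⟨_, h1, _, h2, d.adj⟩

end Network

/-! ### Synchronizing a synchronous algorithm -/

/-- A synchronous algorithm: at time `t`, all nodes simultaneously replace their states `x` by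
`next t i m x`, where `i` is the identifier of the node and `m` collects the weights of the
adjacent edges together with the states at their other ends.  A node in state `x` at time `t` takes
part in this step only if `running t x`. -/
structure SyncAlgorithm where
  State : Type
  init : State
  next : ℕ → ℕ → Multiset (ℕ × State) → State → State
  running : ℕ → State → Prop

/-- The state of a node of a synchronized algorithm: the number of steps that the node has made, and
its two most recent states in the synchronous execution. -/
@[ext]
structure Clocked (σ : Type) where
  clock : ℕ
  cur : σ
  prev : σ

/-- The state that a node shows to a neighbour whose clock is `t`: its own clock is `t` or
`t + 1`. -/
def Clocked.shown {σ : Type} (q : Clocked σ) (t : ℕ) : σ := if q.clock = t then q.cur else q.prev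

namespace SyncAlgorithm

variable {V : Type*} [Fintype V] (A : SyncAlgorithm)

open Classical in
/-- The states of the nodes at time `t` in the synchronous execution.  Here all nodes take part in
all steps: the execution is used only up to a time before which all nodes are running. -/
noncomputable def exec (N : Network V) : ℕ → V → A.State
  | 0, _ => A.init
  | t + 1, v => A.next t (N.ident v)
      ((N.graph.neighborFinset v).val.map fun u => (N.weight s(v, u), exec N t u)) (exec N t v)

/-- The move of the synchronized algorithm: one synchronous step, computed from the states of the
neighbours at the time shown by the clock of the node. -/
def move (x : LocalView (Clocked A.State)) : Clocked A.State where
  clock := x.own.clock + 1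
  cur := A.next x.own.clock x.ident (x.nbrs.map fun y => (y.1, y.2.shown x.own.clock)) x.own.cur
  prev := x.own.cur

/-- The synchronized version of a synchronous algorithm.  A node moves when it is running and no
neighbour is behind it; hence the clocks of neighbours never differ by more than one. -/
def synchronize (encode : Clocked A.State → List Bool) (hencode : Function.Injective encode)
    (pointer : A.State → Option ℕ) : DistAlgorithm where
  State := Clocked A.State
  encode := encode
  encode_injective := hencode
  clean := ⟨0, A.init, A.init⟩
  rule x q := A.running x.own.clock x.own.cur ∧ (∀ y ∈ x.nbrs, x.own.clock ≤ y.2.clock) ∧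
    q = A.move x
  pointer q := pointer q.cur

variable {A} {encode : Clocked A.State → List Bool} {hencode : Function.Injective encode}
  {pointer : A.State → Option ℕ} {N : Network V} {T : ℕ}

/-- The configuration `γ` agrees with the synchronous execution, which ends at time `T`. -/
structure Synchronized (A : SyncAlgorithm) (N : Network V) (T : ℕ) (γ : V → Clocked A.State) :
    Prop where
  clock_le : ∀ v, (γ v).clock ≤ T
  cur_eq : ∀ v, (γ v).cur = A.exec N (γ v).clock v
  prev_eq : ∀ v, (γ v).prev = A.exec N ((γ v).clock - 1) v
  clock_le_succ : ∀ v u, N.graph.Adj v u → (γ v).clock ≤ (γ u).clock + 1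

theorem synchronized_clean : Synchronized A N T
    ((A.synchronize encode hencode pointer).cleanConfig V) :=
  ⟨fun _ => Nat.zero_le _, fun _ => rfl, fun _ => rfl, fun _ _ _ => Nat.zero_le _⟩

variable {γ γ' : V → Clocked A.State}

theorem mem_enabled_iff (hT : ∀ t ≤ T, ∀ v, A.running t (A.exec N t v) ↔ t < T)
    (hγ : Synchronized A N T γ) (v : V) :
    v ∈ (A.synchronize encode hencode pointer).enabled N γ ↔
      (γ v).clock < T ∧ ∀ u, N.graph.Adj v u → (γ v).clock ≤ (γ u).clock := by
  classical
  rw [← hT _ (hγ.clock_le v) v, ← hγ.cur_eq v]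
  simp only [DistAlgorithm.enabled, Set.mem_ofPred_eq, synchronize, DistAlgorithm.view,
    Multiset.mem_map, Finset.mem_val, SimpleGraph.mem_neighborFinset]
  constructor
  · rintro ⟨q, h1, h2, -⟩
    exact ⟨h1, fun u hu => h2 _ ⟨u, hu, rfl⟩⟩
  · rintro ⟨h1, h2⟩
    refine ⟨_, h1, ?_, rfl⟩
    rintro _ ⟨u, hu, rfl⟩
    exact h2 u hu

theorem clock_step {S : Set V}
    (h : (A.synchronize encode hencode pointer).Step N γ S γ') (v : V) :
    (v ∈ S → (γ' v).clock = (γ v).clock + 1) ∧ (v ∉ S → (γ' v).clock = (γ v).clock) := by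
  refine ⟨fun hv => ?_, fun hv => ?_⟩
  · rw [(h.2.2.1 v hv).2.2]
    rfl
  · rw [h.2.2.2 v hv]

theorem Synchronized.step (hT : ∀ t ≤ T, ∀ v, A.running t (A.exec N t v) ↔ t < T)
    (hγ : Synchronized A N T γ) {S : Set V}
    (h : (A.synchronize encode hencode pointer).Step N γ S γ') : Synchronized A N T γ' := by
  classical
  have hen : ∀ v ∈ S, (γ v).clock < T ∧ ∀ u, N.graph.Adj v u → (γ v).clock ≤ (γ u).clock :=
    fun v hv => (mem_enabled_iff hT hγ v).1 (h.2.1 hv)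
  have hmove : ∀ v ∈ S, γ' v = A.move ((A.synchronize encode hencode pointer).view N γ v) :=
    fun v hv => (h.2.2.1 v hv).2.2
  have hclock := fun v => clock_step h v
  refine ⟨fun v => ?_, fun v => ?_, fun v => ?_, fun v u hvu => ?_⟩
  · by_cases hv : v ∈ S
    · rw [(hclock v).1 hv]
      exact (hen v hv).1
    · rw [(hclock v).2 hv]
      exact hγ.clock_le v
  · by_cases hv : v ∈ S
    · rw [(hclock v).1 hv, hmove v hv]
      simp only [move, DistAlgorithm.view, exec]
      rw [hγ.cur_eq v]
      congr 1
      refine (Multiset.map_map _ _ _).trans (Multiset.map_congr rfl fun u hu => ?_)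
      have hvu : N.graph.Adj v u := by simpa using hu
      have h1 := (hen v hv).2 u hvu
      have h2 := hγ.clock_le_succ u v hvu.symm
      have hat : (γ u).shown (γ v).clock = A.exec N (γ v).clock u := by
        rw [Clocked.shown]
        split_ifs with hc
        · rw [hγ.cur_eq u, hc]
        · rw [hγ.prev_eq u, show (γ u).clock - 1 = (γ v).clock by lia]
      exact congrArg (Prod.mk (N.weight s(v, u))) hat
    · rw [(hclock v).2 hv, h.2.2.2 v hv]
      exact hγ.cur_eq v
  · by_cases hv : v ∈ S
    · rw [(hclock v).1 hv, hmove v hv]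
      exact hγ.cur_eq v
    · rw [(hclock v).2 hv, h.2.2.2 v hv]
      exact hγ.prev_eq v
  · have h0 := hγ.clock_le_succ v u hvu
    have h1 : v ∈ S → (γ v).clock ≤ (γ u).clock := fun hv => (hen v hv).2 u hvu
    have hv1 := (hclock v).1
    have hv2 := (hclock v).2
    have hu1 := (hclock u).1
    have hu2 := (hclock u).2
    by_cases hv : v ∈ S <;> by_cases hu : u ∈ S <;> grind

/-- After `r` rounds every clock shows at least `r`: a node whose clock shows exactly `r` is still
awaited by the current round. -/
structure RoundInvariant (A : SyncAlgorithm) (N : Network V) (T r : ℕ) (P : Set V)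
    (γ : V → Clocked A.State) : Prop extends Synchronized A N T γ where
  round_le : r ≤ T
  le_clock : ∀ v, r ≤ (γ v).clock
  mem_pending : ∀ v, (γ v).clock = r → r < T → v ∈ P

theorem roundInvariant_of_run (hT : ∀ t ≤ T, ∀ v, A.running t (A.exec N t v) ↔ t < T)
    {r : ℕ} {P : Set V} {γ : (A.synchronize encode hencode pointer).Config V}
    (h : (A.synchronize encode hencode pointer).Run N r P γ) : RoundInvariant A N T r P γ := by
  induction h with
  | start =>
    refine ⟨synchronized_clean, Nat.zero_le _, fun _ => Nat.zero_le _, fun v _ h0 => ?_⟩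
    exact (mem_enabled_iff hT synchronized_clean v).2 ⟨h0, fun _ _ => Nat.zero_le _⟩
  | @sameRound r P S γ γ' _ hs _ ih =>
    have hγ' := ih.toSynchronized.step hT hs
    have hmono : ∀ v, (γ v).clock ≤ (γ' v).clock := fun v => by
      by_cases hv : v ∈ S
      · rw [(clock_step hs v).1 hv]
        exact Nat.le_succ _
      · rw [(clock_step hs v).2 hv]
    have hle : ∀ v, r ≤ (γ' v).clock := fun v => (ih.le_clock v).trans (hmono v)
    refine ⟨hγ', ih.round_le, hle, fun v hv hr => ?_⟩
    have hv' : (γ v).clock = r := le_antisymm (hv ▸ hmono v) (ih.le_clock v)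
    refine ⟨ih.mem_pending v hv' hr, fun hvS => ?_, ?_⟩
    · have := (clock_step hs v).1 hvS
      lia
    · exact (mem_enabled_iff hT hγ' v).2 ⟨hv ▸ hr, fun u _ => hv ▸ hle u⟩
  | @endRound r P S γ γ' _ hs hP ih =>
    have hγ' := ih.toSynchronized.step hT hs
    have hmono : ∀ v, (γ v).clock ≤ (γ' v).clock := fun v => by
      by_cases hv : v ∈ S
      · rw [(clock_step hs v).1 hv]
        exact Nat.le_succ _
      · rw [(clock_step hs v).2 hv]
    have hle : ∀ v, r ≤ (γ' v).clock := fun v => (ih.le_clock v).trans (hmono v)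
    have hr : r < T := by
      obtain ⟨v, hv⟩ := hs.1
      exact (ih.le_clock v).trans_lt ((mem_enabled_iff hT ih.toSynchronized v).1 (hs.2.1 hv)).1
    have hlt : ∀ v, r + 1 ≤ (γ' v).clock := by
      intro v
      by_contra hv
      have hv1 : (γ' v).clock = r := by have := hle v; lia
      have hv' : (γ v).clock = r := le_antisymm (hv1 ▸ hmono v) (ih.le_clock v)
      have hmem : v ∈ (A.synchronize encode hencode pointer).stillPending N P S γ' := by
        refine ⟨ih.mem_pending v hv' hr, fun hvS => ?_, ?_⟩
        · have := (clock_step hs v).1 hvS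
          lia
        · exact (mem_enabled_iff hT hγ' v).2 ⟨hv1 ▸ hr, fun u _ => hv1 ▸ hle u⟩
      rw [hP] at hmem
      exact hmem
    refine ⟨hγ', hr, hlt, fun v hv hr' => ?_⟩
    exact (mem_enabled_iff hT hγ' v).2 ⟨hv ▸ hr', fun u _ => hv ▸ hlt u⟩

/-- In a terminal configuration all clocks show the final time: otherwise a node with the smallest
clock could move. -/
theorem Synchronized.clock_eq_of_terminal
    (hT : ∀ t ≤ T, ∀ v, A.running t (A.exec N t v) ↔ t < T) (hγ : Synchronized A N T γ)
    (h : (A.synchronize encode hencode pointer).Terminal N γ) (v : V) : (γ v).clock = T := by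
  obtain ⟨u, -, hu⟩ := Finset.exists_min_image Finset.univ (fun u => (γ u).clock)
    ⟨v, Finset.mem_univ v⟩
  refine le_antisymm (hγ.clock_le v) (le_of_not_gt fun hv => ?_)
  have hmem := (mem_enabled_iff (encode := encode) (hencode := hencode) (pointer := pointer)
    hT hγ u).2 ⟨(hu v (Finset.mem_univ v)).trans_lt hv, fun w _ => hu w (Finset.mem_univ w)⟩
  rw [h] at hmem
  exact hmem

theorem alwaysTerminates (hT : ∀ t ≤ T, ∀ v, A.running t (A.exec N t v) ↔ t < T) :
    (A.synchronize encode hencode pointer).AlwaysTerminates N := by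
  rintro ⟨γ, h0, hstep⟩
  have hsync : ∀ i, Synchronized A N T (γ i) := by
    intro i
    induction i with
    | zero => rw [h0]; exact synchronized_clean
    | succ i ih => obtain ⟨S, hS⟩ := hstep i; exact ih.step hT hS
  -- every step increases the sum of the clocks, which is bounded
  have hsum : ∀ i, i ≤ ∑ v, (γ i v).clock := by
    intro i
    induction i with
    | zero => exact Nat.zero_le _
    | succ i ih =>
      obtain ⟨S, hS⟩ := hstep i
      refine Nat.succ_le_of_lt (ih.trans_lt (Finset.sum_lt_sum (fun v _ => ?_) ?_))
      · by_cases hv : v ∈ S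
        · rw [(clock_step hS v).1 hv]
          exact Nat.le_succ _
        · rw [(clock_step hS v).2 hv]
      · obtain ⟨v, hv⟩ := hS.1
        exact ⟨v, Finset.mem_univ v, by rw [(clock_step hS v).1 hv]; exact Nat.lt_succ_self _⟩
  have hbound := (hsum (Fintype.card V * T + 1)).trans
    (Finset.sum_le_sum fun v _ => (hsync _).clock_le v)
  rw [Finset.sum_const, Finset.card_univ, smul_eq_mul] at hbound
  lia

end SyncAlgorithm

/-! ### Prim's algorithm as a synchronous algorithm -/

/-- The name of an edge that leaves the tree grown by Prim's algorithm: its weight, the identifier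
of its end outside the tree, and the identifier of its end in the tree.  Names are compared
lexicographically. -/
abbrev EdgeName := ℕ ×ₗ ℕ ×ₗ ℕ

/-- The state of a node in the synchronous version of Prim's algorithm.

* `ident` is the identifier of the node (`0` before the first step);
* `leader` is the largest identifier that the node has heard of;
* `best` is the least edge name that the node has heard of in the current phase (`⊤` for none);
* `pointer` is the identifier of the parent in the tree. -/
@[ext]
structure PrimState where
  ident : ℕ
  leader : ℕ
  best : WithTop EdgeName
  pointer : Option ℕ

namespace PrimState

/-- The node belongs to the tree: it has a parent, or it is the leader, which is the root. -/
def InTree (q : PrimState) : Prop := q.pointer ≠ none ∨ q.ident = q.leader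

instance : DecidablePred InTree := fun _ => inferInstanceAs (Decidable (_ ∨ _))

/-- The least name of an edge that joins the node, which is outside the tree, to the tree. -/
def candidate (i : ℕ) (m : Multiset (ℕ × PrimState)) (q : PrimState) : WithTop EdgeName :=
  if q.InTree then ⊤ else
    (m.map fun y => if y.2.InTree then
      ((toLex (y.1, toLex (i, y.2.ident)) : EdgeName) : WithTop EdgeName) else ⊤).inf

/-- The pointer of a node at the end of a phase that has selected the edge named `b`: if this edge
joins the node to the tree, the node points to the other end of the edge; otherwise it keeps its
pointer `p`. -/
def commit (i : ℕ) (p : Option ℕ) : WithTop EdgeName → Option ℕ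
  | ⊤ => p
  | (e : EdgeName) => if (ofLex (ofLex e).2).1 = i then some (ofLex (ofLex e).2).2 else p

theorem commit_top (i : ℕ) (p : Option ℕ) : commit i p ⊤ = p := rfl

theorem commit_coe (i : ℕ) (p : Option ℕ) (e : EdgeName) : commit i p e =
    if (ofLex (ofLex e).2).1 = i then some (ofLex (ofLex e).2).2 else p := rfl

/-- One synchronous step of a node.  Times up to the largest identifier only serve to find it; from
then on, a phase begins at each multiple of the largest identifier plus one. -/
def next (t i : ℕ) (m : Multiset (ℕ × PrimState)) (q : PrimState) : PrimState where
  ident := i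
  leader := i ⊔ q.leader ⊔ (m.map fun y => y.2.leader).sup
  best := if t ≤ q.leader ∨ q.leader + 1 ∣ t then ⊤ else
    q.best ⊓ candidate i m q ⊓ (m.map fun y => y.2.best).inf
  pointer := if t ≤ q.leader ∨ ¬ q.leader + 1 ∣ t then q.pointer else
    commit i q.pointer q.best

end PrimState

/-- Prim's algorithm as a synchronous algorithm. -/
def primSync : SyncAlgorithm where
  State := PrimState
  init := ⟨0, 0, ⊤, none⟩
  next := PrimState.next
  running t q := t < (q.leader + 1) ^ 2

/-- A property that passes from a node to itself and to its neighbours in every step has passed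
along a walk after as many steps as the walk is long. -/
theorem SimpleGraph.Walk.spread {V : Type*} {G : SimpleGraph V} {Q : ℕ → V → Prop} {a b : ℕ}
    (hself : ∀ t, a ≤ t → t < b → ∀ v, Q t v → Q (t + 1) v)
    (hadj : ∀ t, a ≤ t → t < b → ∀ v u, G.Adj v u → Q t u → Q (t + 1) v)
    {v u : V} (w : G.Walk v u) (hu : Q a u) {t : ℕ} (ht : a + w.length ≤ t) (htb : t ≤ b) :
    Q t v := by
  induction w generalizing t with
  | nil =>
    induction t, ht using Nat.le_induction with
    | base => exact hu
    | succ t ht ih => exact hself t (by simpa using ht) htb _ (ih (by lia))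
  | cons h p ih =>
    rw [SimpleGraph.Walk.length_cons] at ht
    obtain ⟨t, rfl⟩ : ∃ t', t = t' + 1 := ⟨t - 1, by lia⟩
    exact hadj t (by lia) htb _ _ h (ih hu (by lia) (by lia))

namespace Network

variable {V : Type*} [Fintype V] (N : Network V)

/-- The state of the node `v` at time `t` in the synchronous execution of Prim's algorithm. -/
noncomputable abbrev primExec (t : ℕ) (v : V) : PrimState := primSync.exec N t v

/-- The largest identifier. -/
def maxIdent : ℕ := Finset.univ.sup N.ident

variable {N}

theorem ident_le_maxIdent (v : V) : N.ident v ≤ N.maxIdent :=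
  Finset.le_sup (f := N.ident) (Finset.mem_univ v)

theorem exists_ident_eq_maxIdent (N : Network V) : ∃ r, N.ident r = N.maxIdent := by
  have := N.connected.nonempty
  obtain ⟨r, -, hr⟩ := Finset.exists_mem_eq_sup Finset.univ Finset.univ_nonempty N.ident
  exact ⟨r, hr.symm⟩

theorem card_le_maxIdent (hid : ∀ v, 1 ≤ N.ident v) : Fintype.card V ≤ N.maxIdent := by
  have h := Finset.card_le_card_of_injOn (s := Finset.univ) (t := Finset.Icc 1 N.maxIdent) N.ident
    (fun v _ => Finset.mem_coe.2 (Finset.mem_Icc.2 ⟨hid v, ident_le_maxIdent v⟩))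
    N.ident_injective.injOn
  simpa using h

theorem primExec_succ_ident (t : ℕ) (v : V) : (N.primExec (t + 1) v).ident = N.ident v := rfl

/-- The weights of the edges of `v` together with the states of its neighbours at time `t`. -/
noncomputable abbrev primNbrs (N : Network V) (t : ℕ) (v : V) : Multiset (ℕ × PrimState) :=
  open Classical in
  (N.graph.neighborFinset v).val.map fun u => (N.weight s(v, u), N.primExec t u)

theorem primExec_succ (t : ℕ) (v : V) : N.primExec (t + 1) v =
    PrimState.next t (N.ident v) (N.primNbrs t v) (N.primExec t v) := rfl

theorem mem_primNbrs {t : ℕ} {v : V} {y : ℕ × PrimState} :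
    y ∈ N.primNbrs t v ↔ ∃ u, N.graph.Adj v u ∧ (N.weight s(v, u), N.primExec t u) = y := by
  classical
  simp [primNbrs]

theorem leader_le (t : ℕ) (v : V) : (N.primExec t v).leader ≤ N.maxIdent := by
  induction t generalizing v with
  | zero => exact Nat.zero_le _
  | succ t ih =>
    rw [primExec_succ]
    refine sup_le (sup_le (ident_le_maxIdent v) (ih v)) (Multiset.sup_le.2 fun b hb => ?_)
    obtain ⟨y, hy, rfl⟩ := Multiset.mem_map.1 hb
    obtain ⟨u, -, rfl⟩ := mem_primNbrs.1 hy
    exact ih u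

theorem ident_le_leader {v u : V} (w : N.graph.Walk v u) {t : ℕ} (ht : w.length < t) :
    N.ident u ≤ (N.primExec t v).leader := by
  refine SimpleGraph.Walk.spread (Q := fun t v => N.ident u ≤ (N.primExec t v).leader)
    (a := 1) (b := t)
    (fun t _ _ v h => ?_) (fun t _ _ v x hvx h => ?_) w ?_ (by lia) le_rfl
  · exact h.trans (le_sup_right.trans le_sup_left)
  · refine h.trans (le_trans ?_ le_sup_right)
    exact Multiset.le_sup (Multiset.mem_map_of_mem (fun y : ℕ × PrimState => y.2.leader)
      (mem_primNbrs.2 ⟨x, hvx, rfl⟩))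
  · exact le_sup_left.trans le_sup_left

/-- A node knows that it has heard of the largest identifier as soon as the time exceeds the largest
identifier that it has heard of.  By time `t` the node has heard of all identifiers at distance less
than `t`; if there were a path of length `t` from it, the first `t` nodes of this path would have
distinct positive identifiers, all less than `t`. -/
theorem leader_eq_of_lt (hid : ∀ v, 1 ≤ N.ident v) {t : ℕ} {v : V}
    (h : (N.primExec t v).leader < t) : (N.primExec t v).leader = N.maxIdent := by
  refine le_antisymm (leader_le t v) (Finset.sup_le fun u _ => ?_)
  obtain ⟨p, hp⟩ := N.connected.exists_isPath v u
  refine ident_le_leader p (lt_of_not_ge fun hlen => ?_)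
  have hcard := Finset.card_le_card_of_injOn (s := Finset.range t)
    (t := Finset.Icc 1 (N.primExec t v).leader) (fun i => N.ident (p.getVert i))
    (fun i hi => ?_) (fun i hi j hj hij => ?_)
  · rw [Finset.card_range, Nat.card_Icc] at hcard
    lia
  · have hi' : i < t := by simpa using hi
    refine Finset.mem_coe.2 (Finset.mem_Icc.2 ⟨hid _, ident_le_leader (p.take i) ?_⟩)
    rw [SimpleGraph.Walk.take_length]
    exact (min_le_left _ _).trans_lt hi'
  · have hi' : i < t := by simpa using hi
    have hj' : j < t := by simpa using hj
    exact hp.getVert_injOn (by simp; lia) (by simp; lia) (N.ident_injective hij)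

theorem leader_eq (hid : ∀ v, 1 ≤ N.ident v) {t : ℕ} (ht : N.maxIdent < t) (v : V) :
    (N.primExec t v).leader = N.maxIdent :=
  leader_eq_of_lt hid ((leader_le t v).trans_lt ht)

theorem le_leader (hid : ∀ v, 1 ≤ N.ident v) {t : ℕ} (ht : t ≤ N.maxIdent) (v : V) :
    t ≤ (N.primExec t v).leader := by
  by_contra! h
  have := leader_eq_of_lt hid h
  lia

theorem primSync_running_iff (hid : ∀ v, 1 ≤ N.ident v) (t : ℕ) (v : V) :
    primSync.running t (primSync.exec N t v) ↔ t < (N.maxIdent + 1) ^ 2 := by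
  change t < ((N.primExec t v).leader + 1) ^ 2 ↔ _
  rcases Nat.lt_or_ge N.maxIdent t with h | h
  · rw [leader_eq hid h]
  · have h1 := le_leader hid h v
    exact ⟨fun _ => by nlinarith, fun _ => by nlinarith⟩

theorem primExec_early (hid : ∀ v, 1 ≤ N.ident v) {t : ℕ} (ht : t ≤ N.maxIdent + 1) (v : V) :
    (N.primExec t v).best = ⊤ ∧ (N.primExec t v).pointer = none := by
  induction t with
  | zero => exact ⟨rfl, rfl⟩
  | succ t ih =>
    have h := le_leader hid (Nat.le_of_succ_le_succ ht) v
    rw [primExec_succ]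
    simp only [PrimState.next, h, true_or, if_true]
    exact ⟨trivial, (ih (by lia)).2⟩

theorem primExec_of_dvd (hid : ∀ v, 1 ≤ N.ident v) {t : ℕ} (ht : N.maxIdent < t)
    (hdvd : N.maxIdent + 1 ∣ t) (v : V) :
    (N.primExec (t + 1) v).best = ⊤ ∧
      (N.primExec (t + 1) v).pointer =
        PrimState.commit (N.ident v) (N.primExec t v).pointer (N.primExec t v).best := by
  rw [primExec_succ]
  simp [PrimState.next, leader_eq hid ht, hdvd, ht]

theorem primExec_of_not_dvd (hid : ∀ v, 1 ≤ N.ident v) {t : ℕ} (ht : N.maxIdent < t)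
    (hdvd : ¬ N.maxIdent + 1 ∣ t) (v : V) :
    (N.primExec (t + 1) v).best = (N.primExec t v).best ⊓
        (N.primExec t v).candidate (N.ident v) (N.primNbrs t v) ⊓
          ((N.primNbrs t v).map fun y => y.2.best).inf ∧
      (N.primExec (t + 1) v).pointer = (N.primExec t v).pointer := by
  rw [primExec_succ]
  simp [PrimState.next, leader_eq hid ht, hdvd, ht]

/-- The name of the edge `{v, u}`, where `v` is outside the tree and `u` is in the tree. -/
def edgeName (N : Network V) (v u : V) : EdgeName :=
  toLex (N.weight s(v, u), toLex (N.ident v, N.ident u))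

open Classical in
/-- The least name of an edge that joins the node `v`, which is outside the tree given by the
pointers `P`, to this tree. -/
noncomputable def joinName (N : Network V) (r : V) (P : V → Option ℕ) (v : V) :
    WithTop EdgeName :=
  if v ∈ reached r P then ⊤ else
    (N.graph.neighborFinset v).inf fun u =>
      if u ∈ reached r P then (N.edgeName v u : WithTop EdgeName) else ⊤

theorem inTree_iff (hid : ∀ v, 1 ≤ N.ident v) {r : V} (hr : N.ident r = N.maxIdent) {t : ℕ}
    (ht : N.maxIdent < t) (v : V) :
    (N.primExec t v).InTree ↔ v ∈ reached r fun u => (N.primExec t u).pointer := by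
  obtain ⟨t, rfl⟩ : ∃ t', t = t' + 1 := ⟨t - 1, by lia⟩
  rw [PrimState.InTree, leader_eq hid ht, primExec_succ_ident, ← hr, N.ident_injective.eq_iff,
    or_comm]
  rfl

theorem candidate_eq (hid : ∀ v, 1 ≤ N.ident v) {r : V} (hr : N.ident r = N.maxIdent) {t : ℕ}
    (ht : N.maxIdent < t) (v : V) :
    (N.primExec t v).candidate (N.ident v) (N.primNbrs t v) =
      N.joinName r (fun u => (N.primExec t u).pointer) v := by
  classical
  rw [PrimState.candidate, joinName]
  simp only [inTree_iff hid hr ht]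
  split_ifs with h
  · rfl
  · rw [Multiset.map_map, Finset.inf]
    congr 1
    refine Multiset.map_congr (by congr) fun u _ => ?_
    simp only [Function.comp_apply, inTree_iff hid hr ht]
    obtain ⟨t, rfl⟩ : ∃ t', t = t' + 1 := ⟨t - 1, by lia⟩
    rfl

end Network

/-! ### The phases of Prim's algorithm -/

namespace Network

variable {V : Type*} [Fintype V] {N : Network V}

/-- The pointers at the beginning of phase `k`, just after the selection of phase `k - 1` has been
committed. -/
noncomputable def phasePointer (N : Network V) (k : ℕ) (v : V) : Option ℕ :=
  (N.primExec (k * (N.maxIdent + 1) + 1) v).pointer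

theorem primExec_phase (hid : ∀ v, 1 ≤ N.ident v) {k j : ℕ} (hk : 1 ≤ k) (hj : j ≤ N.maxIdent)
    (v : V) : (N.primExec (k * (N.maxIdent + 1) + 1 + j) v).pointer = N.phasePointer k v := by
  induction j with
  | zero => rfl
  | succ j ih =>
    have hdvd : ¬ N.maxIdent + 1 ∣ k * (N.maxIdent + 1) + 1 + j := by
      rw [add_assoc, Nat.dvd_add_right (dvd_mul_left _ _)]
      exact Nat.not_dvd_of_pos_of_lt (by lia) (by lia)
    have ht : N.maxIdent < k * (N.maxIdent + 1) + 1 + j := by nlinarith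
    rw [← add_assoc, (primExec_of_not_dvd hid ht hdvd v).2, ih (by lia)]

/-- At the end of a phase every node knows the least name of an edge leaving the tree. -/
theorem best_phase_end (hid : ∀ v, 1 ≤ N.ident v) {r : V} (hr : N.ident r = N.maxIdent) {k : ℕ}
    (hk : 1 ≤ k) (v : V) :
    (N.primExec ((k + 1) * (N.maxIdent + 1)) v).best =
      Finset.univ.inf (N.joinName r (N.phasePointer k)) := by
  set a := k * (N.maxIdent + 1) with ha
  have hend : (k + 1) * (N.maxIdent + 1) = a + 1 + N.maxIdent := by rw [ha]; ring
  have hlt : N.maxIdent < a := by nlinarith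
  have hcard := card_le_maxIdent hid
  -- within the phase, the least name is only ever lowered to the names in the neighbourhood
  have hstep : ∀ t, a + 1 ≤ t → t < a + 1 + N.maxIdent → ∀ x, (N.primExec (t + 1) x).best =
      (N.primExec t x).best ⊓ N.joinName r (N.phasePointer k) x ⊓
        ((N.primNbrs t x).map fun y => y.2.best).inf := by
    intro t h1 h2 x
    obtain ⟨j, rfl⟩ := Nat.exists_eq_add_of_le h1
    have hdvd : ¬ N.maxIdent + 1 ∣ a + 1 + j := by
      rw [add_assoc, Nat.dvd_add_right (ha ▸ dvd_mul_left _ _)]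
      exact Nat.not_dvd_of_pos_of_lt (by lia) (by lia)
    have ht : N.maxIdent < a + 1 + j := by lia
    rw [(primExec_of_not_dvd hid ht hdvd x).1, candidate_eq hid hr ht]
    congr 3
    exact funext fun u => primExec_phase hid hk (by lia) u
  rw [hend]
  refine le_antisymm (Finset.le_inf fun u _ => ?_) ?_
  · obtain ⟨p, hp⟩ := N.connected.exists_isPath v u
    have hlen := hp.length_lt
    refine SimpleGraph.Walk.spread
      (Q := fun t x => (N.primExec t x).best ≤ N.joinName r (N.phasePointer k) u)
      -- the best names are `⊤` at time `a + 1` and include the node's own candidate from `a + 2` on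
      (a := a + 2) (b := a + 1 + N.maxIdent)
      (fun t h1 h2 x h => ?_) (fun t h1 h2 x y hxy h => ?_) p ?_ (by lia) le_rfl
    · rw [hstep t (by lia) h2]
      exact inf_le_left.trans (inf_le_left.trans h)
    · rw [hstep t (by lia) h2]
      refine inf_le_right.trans (le_trans ?_ h)
      exact Multiset.inf_le (Multiset.mem_map_of_mem (fun y : ℕ × PrimState => y.2.best)
        (mem_primNbrs.2 ⟨y, hxy, rfl⟩))
    · rw [hstep (a + 1) le_rfl (by lia)]
      exact inf_le_left.trans inf_le_right
  · have hinv : ∀ j ≤ N.maxIdent, ∀ x, Finset.univ.inf (N.joinName r (N.phasePointer k)) ≤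
        (N.primExec (a + 1 + j) x).best := by
      intro j
      induction j with
      | zero =>
        intro _ x
        rw [add_zero, (primExec_of_dvd hid hlt (ha ▸ dvd_mul_left _ _) x).1]
        exact le_top
      | succ j ih =>
        intro hj x
        rw [← add_assoc, hstep _ (by lia) (by lia)]
        refine le_inf (le_inf (ih (by lia) x) (Finset.inf_le (Finset.mem_univ x)))
          (Multiset.le_inf.2 fun b hb => ?_)
        obtain ⟨y, hy, rfl⟩ := Multiset.mem_map.1 hb
        obtain ⟨u, -, rfl⟩ := mem_primNbrs.1 hy
        exact ih (by lia) u
    exact hinv _ le_rfl v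

theorem phasePointer_one (hid : ∀ v, 1 ≤ N.ident v) : N.phasePointer 1 = fun _ => none := by
  funext v
  have h := primExec_early hid le_rfl v
  rw [phasePointer, one_mul,
    (primExec_of_dvd hid (Nat.lt_succ_self _) dvd_rfl v).2, h.1, PrimState.commit_top]
  exact h.2

theorem joinName_ne_top_iff {r : V} {P : V → Option ℕ} {v : V} :
    N.joinName r P v ≠ ⊤ ↔ v ∉ reached r P ∧ ∃ u ∈ reached r P, N.graph.Adj v u := by
  classical
  rw [joinName]
  split_ifs with h
  · simp [h]
  · rw [Ne, Finset.inf_eq_top_iff]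
    simp [h, and_comm]

theorem exists_edgeName_of_joinName_ne_top {r : V} {P : V → Option ℕ} {v : V}
    (h : N.joinName r P v ≠ ⊤) :
    ∃ u ∈ reached r P, N.graph.Adj v u ∧ N.joinName r P v = N.edgeName v u := by
  classical
  obtain ⟨hv, u₀, hu₀, hadj⟩ := joinName_ne_top_iff.1 h
  have hne : (N.graph.neighborFinset v).Nonempty := ⟨u₀, by simpa using hadj⟩
  rw [joinName, if_neg hv] at h ⊢
  obtain ⟨u, hu, heq⟩ := Finset.exists_mem_eq_inf _ hne fun u =>
      if u ∈ reached r P then (N.edgeName v u : WithTop EdgeName) else ⊤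
  rw [heq] at h ⊢
  by_cases hur : u ∈ reached r P
  · exact ⟨u, hur, by simpa using hu, if_pos hur⟩
  · simp [hur] at h

theorem joinName_le {r : V} {P : V → Option ℕ} {v u : V} (hv : v ∉ reached r P)
    (hu : u ∈ reached r P) (hvu : N.graph.Adj v u) : N.joinName r P v ≤ N.edgeName v u := by
  classical
  rw [joinName, if_neg hv]
  refine (Finset.inf_le (by simpa using hvu)).trans ?_
  rw [if_pos hu]

/-- Each phase performs one step of Prim's algorithm, unless the tree already spans the network. -/
theorem phase_step (hid : ∀ v, 1 ≤ N.ident v) {r : V} (hr : N.ident r = N.maxIdent) {k : ℕ}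
    (hk : 1 ≤ k) (h : N.PrimInvariant r (N.phasePointer k)) :
    N.PrimInvariant r (N.phasePointer (k + 1)) ∧
      (reached r (N.phasePointer k) = Set.univ → reached r (N.phasePointer (k + 1)) = Set.univ) ∧
      (reached r (N.phasePointer k) ≠ Set.univ →
        reached r (N.phasePointer k) ⊂ reached r (N.phasePointer (k + 1))) := by
  classical
  have hnew : ∀ v, N.phasePointer (k + 1) v =
      PrimState.commit (N.ident v) (N.phasePointer k v)
        (Finset.univ.inf (N.joinName r (N.phasePointer k))) := by
    intro v
    have hptr : (N.primExec ((k + 1) * (N.maxIdent + 1)) v).pointer = N.phasePointer k v := by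
      rw [← primExec_phase hid hk le_rfl v]
      congr 2
      ring
    rw [phasePointer, (primExec_of_dvd hid (by nlinarith) (dvd_mul_left _ _) v).2,
      best_phase_end hid hr hk, hptr]
  have := N.connected.nonempty
  obtain ⟨v, -, hv⟩ := Finset.exists_mem_eq_inf Finset.univ Finset.univ_nonempty
    (N.joinName r (N.phasePointer k))
  by_cases htop : N.joinName r (N.phasePointer k) v = ⊤
  · have hsame : N.phasePointer (k + 1) = N.phasePointer k := funext fun x => by
      rw [hnew x, hv, htop, PrimState.commit_top]
    have hall : reached r (N.phasePointer k) = Set.univ := by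
      by_contra hne
      obtain ⟨x, hx, y, hy, hxy⟩ := N.exists_adj_of_reached_ne_univ hne
      refine joinName_ne_top_iff.2 ⟨hy, x, hx, hxy.symm⟩ (top_le_iff.1 ?_)
      rw [← htop, ← hv]
      exact Finset.inf_le (Finset.mem_univ y)
    rw [hsame]
    exact ⟨h, id, fun hne => absurd hall hne⟩
  · obtain ⟨u, hu, hvu, heq⟩ := exists_edgeName_of_joinName_ne_top htop
    have hvr := (joinName_ne_top_iff.1 htop).1
    have hupd : N.phasePointer (k + 1) =
        Function.update (N.phasePointer k) v (some (N.ident u)) := funext fun x => by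
      rw [hnew x, hv, heq, PrimState.commit_coe]
      by_cases hx : x = v
      · subst hx
        simp [edgeName]
      · rw [Function.update_of_ne hx]
        refine if_neg fun h' => hx ?_
        exact (N.ident_injective h').symm
    have hsub : reached r (N.phasePointer k) ⊂ reached r (N.phasePointer (k + 1)) := by
      refine (Set.ssubset_iff_of_subset fun x hx => ?_).2 ⟨v, Or.inr ?_, hvr⟩
      · have hxv : x ≠ v := fun h' => hvr (h' ▸ hx)
        refine hx.imp id fun h' => ?_
        rwa [hupd, Function.update_of_ne hxv]
      · simp [hupd]
    refine ⟨?_, fun hall => absurd (hall ▸ Set.mem_univ v) hvr, fun _ => hsub⟩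
    rw [hupd]
    refine h.update hu hvr hvu.symm fun x hx y hy hxy => ?_
    have hle : (N.edgeName v u : WithTop EdgeName) ≤ N.edgeName y x := by
      rw [← heq, ← hv]
      exact (Finset.inf_le (Finset.mem_univ y)).trans (joinName_le hy hx hxy.symm)
    have hw := Prod.Lex.monotone_fst _ _ (WithTop.coe_le_coe.1 hle)
    rw [Sym2.eq_swap, Sym2.eq_swap (a := x)]
    exact hw

theorem primInvariant_phase (hid : ∀ v, 1 ≤ N.ident v) {r : V} (hr : N.ident r = N.maxIdent)
    {k : ℕ} (hk : 1 ≤ k) : N.PrimInvariant r (N.phasePointer k) ∧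
      (reached r (N.phasePointer k) = Set.univ ∨ k ≤ (reached r (N.phasePointer k)).ncard) := by
  induction k, hk using Nat.le_induction with
  | base =>
    rw [phasePointer_one hid]
    refine ⟨N.primInvariant_none r, Or.inr ?_⟩
    exact (Set.ncard_pos (Set.toFinite _)).2 ⟨r, Or.inl rfl⟩
  | succ k hk ih =>
    obtain ⟨h1, h2, h3⟩ := phase_step hid hr hk ih.1
    refine ⟨h1, ?_⟩
    by_cases hall : reached r (N.phasePointer k) = Set.univ
    · exact Or.inl (h2 hall)
    · exact Or.inr ((ih.2.resolve_left hall).trans_lt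
        (Set.ncard_lt_ncard (h3 hall) (Set.toFinite _)))

theorem isMST_primExec (hid : ∀ v, 1 ≤ N.ident v) :
    N.IsMST (N.pointerGraph fun v => (N.primExec ((N.maxIdent + 1) ^ 2) v).pointer) := by
  obtain ⟨r, hr⟩ := N.exists_ident_eq_maxIdent
  have := N.connected.nonempty
  have hcard := card_le_maxIdent hid
  have hM : 1 ≤ N.maxIdent := Fintype.card_pos.trans_le hcard
  obtain ⟨h1, h2⟩ := primInvariant_phase hid hr hM
  have hfin : (fun v => (N.primExec ((N.maxIdent + 1) ^ 2) v).pointer) =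
      N.phasePointer N.maxIdent := funext fun v => by
    rw [← primExec_phase hid hM le_rfl v]
    congr 2
    ring
  rw [hfin]
  refine h1.isMST (h2.elim id fun h =>
    Set.eq_of_subset_of_ncard_le (Set.subset_univ _) ?_)
  rw [Set.ncard_univ, Nat.card_eq_fintype_card]
  exact hcard.trans h

end Network

/-! ### Encoding of states and space -/

theorem Nat.bits_injective : Function.Injective Nat.bits := fun m n h =>
  Nat.eq_of_testBit_eq fun i => by rw [Nat.testBit_eq_inth, Nat.testBit_eq_inth, h]

/-- The self-delimiting code of a string of bits: each bit is preceded by `true`, and `false` marks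
the end. -/
def delimit : List Bool → List Bool
  | [] => [false]
  | b :: l => true :: b :: delimit l

theorem length_delimit (l : List Bool) : (delimit l).length = 2 * l.length + 1 := by
  induction l with
  | nil => rfl
  | cons b l ih => simp only [delimit, List.length_cons, ih]; ring

theorem delimit_append_inj {l l' m m' : List Bool} (h : delimit l ++ m = delimit l' ++ m') :
    l = l' ∧ m = m' := by
  induction l generalizing l' with
  | nil => cases l' with
    | nil => simpa [delimit] using h
    | cons b l' => simp [delimit] at h
  | cons b l ih => cases l' with
    | nil => simp [delimit] at h
    | cons b' l' =>
      simp only [delimit, List.cons_append, List.cons.injEq, true_and] at h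
      obtain ⟨rfl, rfl⟩ := ih h.2
      exact ⟨by rw [h.1], rfl⟩

/-- The code of a list of natural numbers as a string of bits. -/
def encodeList (l : List ℕ) : List Bool := l.flatMap fun n => delimit n.bits

theorem encodeList_injective : Function.Injective encodeList := by
  intro l
  induction l with
  | nil =>
    rintro (_ | ⟨n, l'⟩) h
    · rfl
    · have := congrArg List.length h
      simp [encodeList, length_delimit] at this
      lia
  | cons m l ih =>
    rintro (_ | ⟨n, l'⟩) h
    · have := congrArg List.length h
      simp [encodeList, length_delimit] at this
    · simp only [encodeList, List.flatMap_cons] at h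
      obtain ⟨h1, h2⟩ := delimit_append_inj h
      rw [Nat.bits_injective h1, ih h2]

theorem length_encodeList_le {l : List ℕ} {b : ℕ} (h : ∀ n ∈ l, n.size ≤ b) :
    (encodeList l).length ≤ l.length * (2 * b + 1) := by
  rw [encodeList, List.length_flatMap]
  refine (List.sum_le_card_nsmul _ (2 * b + 1) fun x hx => ?_).trans_eq (by simp)
  obtain ⟨n, hn, rfl⟩ := List.mem_map.1 hx
  rw [length_delimit, Nat.size_eq_bits_len]
  have := h n hn
  lia

/-- The numbers that make up an optional edge name. -/
def edgeCodes : WithTop EdgeName → List ℕ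
  | ⊤ => [0, 0, 0, 0]
  | (e : EdgeName) => [1, (ofLex e).1, (ofLex (ofLex e).2).1, (ofLex (ofLex e).2).2]

theorem length_edgeCodes (b : WithTop EdgeName) : (edgeCodes b).length = 4 := by
  cases b <;> rfl

theorem edgeCodes_injective : Function.Injective edgeCodes := by
  intro b b' h
  cases b with
  | top => cases b' with
    | top => rfl
    | coe e => simp [edgeCodes] at h
  | coe e => cases b' with
    | top => simp [edgeCodes] at h
    | coe e' =>
      simp only [edgeCodes, List.cons.injEq, true_and, and_true] at h
      exact congrArg _ (ofLex.injective (Prod.ext h.1 (ofLex.injective (Prod.ext h.2.1 h.2.2))))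

namespace PrimState

/-- The numbers that make up the state of a node in the synchronous algorithm. -/
def codes (q : PrimState) : List ℕ :=
  [q.ident, q.leader, q.pointer.elim 0 Nat.succ] ++ edgeCodes q.best

theorem length_codes (q : PrimState) : q.codes.length = 7 := by
  simp [codes, length_edgeCodes]

theorem codes_injective : Function.Injective codes := by
  intro q q' h
  obtain ⟨h1, h2⟩ := List.append_inj h rfl
  simp only [List.cons.injEq, and_true] at h1
  refine PrimState.ext h1.1 h1.2.1 (edgeCodes_injective h2) ?_
  cases hq : q.pointer <;> cases hq' : q'.pointer <;> simp_all

end PrimState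

/-- The numbers that make up the state of a node. -/
def clockedCodes (q : Clocked PrimState) : List ℕ := q.clock :: (q.cur.codes ++ q.prev.codes)

theorem clockedCodes_injective : Function.Injective clockedCodes := by
  intro q q' h
  obtain ⟨h1, h2⟩ := List.cons.inj h
  obtain ⟨h2, h3⟩ := List.append_inj h2 (by simp only [PrimState.length_codes])
  exact Clocked.ext h1 (PrimState.codes_injective h2) (PrimState.codes_injective h3)

/-- The distributed version of Prim's algorithm. -/
def primAlgorithm : DistAlgorithm :=
  primSync.synchronize (fun q => encodeList (clockedCodes q))
    (encodeList_injective.comp clockedCodes_injective) PrimState.pointer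

namespace Network

variable {V : Type*} [Fintype V] {N : Network V}

/-- Bounds on the numbers in the state of a node: `w` bounds weights, and `M` identifiers. -/
structure StateBounded (w M : ℕ) (q : PrimState) : Prop where
  ident_le : q.ident ≤ M
  leader_le : q.leader ≤ M
  best_le : ∀ e : EdgeName, q.best = e →
    (ofLex e).1 < w ∧ (ofLex (ofLex e).2).1 ≤ M ∧ (ofLex (ofLex e).2).2 ≤ M
  pointer_le : ∀ a, q.pointer = some a → a ≤ M

theorem stateBounded_primExec {w : ℕ} (hw : ∀ e ∈ N.graph.edgeSet, N.weight e < w) (t : ℕ) (v : V) :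
    StateBounded w N.maxIdent (N.primExec t v) := by
  induction t generalizing v with
  | zero => exact ⟨Nat.zero_le _, Nat.zero_le _, fun e h => (nomatch h), fun a h => (nomatch h)⟩
  | succ t ih =>
    -- an infimum of edge names is one of them, if it is not `⊤`
    have hinf : ∀ m : Multiset (WithTop EdgeName), ∀ e : EdgeName, m.inf = e → ↑e ∈ m := by
      intro m
      induction m using Multiset.induction with
      | empty => intro e h; simp at h
      | cons b m ihm =>
        intro e h
        rw [Multiset.inf_cons] at h
        rcases min_choice b m.inf with h' | h'
        · exact Multiset.mem_cons.2 (Or.inl (h.symm.trans h'))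
        · exact Multiset.mem_cons_of_mem (ihm e (h'.symm.trans h))
    refine ⟨ident_le_maxIdent v, leader_le _ _, fun e he => ?_, fun a ha => ?_⟩
    · rw [primExec_succ] at he
      simp only [PrimState.next] at he
      split_ifs at he with h1
      · exact nomatch he
      · rcases min_choice ((N.primExec t v).best ⊓
          (N.primExec t v).candidate (N.ident v) (N.primNbrs t v))
          ((N.primNbrs t v).map fun y => y.2.best).inf with h' | h'
        · rcases min_choice (N.primExec t v).best
            ((N.primExec t v).candidate (N.ident v) (N.primNbrs t v)) with h'' | h''
          · exact (ih v).best_le e (h''.symm.trans (h'.symm.trans he))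
          · have hc := h''.symm.trans (h'.symm.trans he)
            rw [PrimState.candidate] at hc
            split_ifs at hc with h2
            · exact nomatch hc
            · obtain ⟨y, hy, hye⟩ := Multiset.mem_map.1 (hinf _ e hc)
              obtain ⟨u, hu, rfl⟩ := mem_primNbrs.1 hy
              split_ifs at hye with h3
              · obtain rfl := WithTop.coe_injective hye
                exact ⟨hw _ hu, ident_le_maxIdent v, (ih u).ident_le⟩
              · exact nomatch hye
        · obtain ⟨y, hy, hye⟩ := Multiset.mem_map.1 (hinf _ e (h'.symm.trans he))
          obtain ⟨u, -, rfl⟩ := mem_primNbrs.1 hy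
          exact (ih u).best_le e hye
    · rw [primExec_succ] at ha
      simp only [PrimState.next] at ha
      split_ifs at ha with h1
      · exact (ih v).pointer_le a ha
      · cases hb : (N.primExec t v).best with
        | top =>
          rw [hb] at ha
          exact (ih v).pointer_le a ha
        | coe e =>
          rw [hb, PrimState.commit_coe] at ha
          split_ifs at ha with h2
          · obtain rfl := Option.some.inj ha
            exact ((ih v).best_le e hb).2.2
          · exact (ih v).pointer_le a ha

theorem StateBounded.codes_le {w M : ℕ} {q : PrimState} (h : StateBounded w M q) :
    ∀ x ∈ q.codes, x < w ∨ x ≤ M + 1 := by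
  intro x hx
  rw [PrimState.codes, List.mem_append] at hx
  rcases hx with hx | hx
  · simp only [List.mem_cons, List.not_mem_nil, or_false] at hx
    rcases hx with rfl | rfl | rfl
    · exact Or.inr (h.ident_le.trans (Nat.le_succ _))
    · exact Or.inr (h.leader_le.trans (Nat.le_succ _))
    · cases hq : q.pointer with
      | none => exact Or.inr (Nat.zero_le _)
      | some a => exact Or.inr (Nat.succ_le_succ (h.pointer_le a hq))
  · cases hb : q.best with
    | top =>
      rw [hb] at hx
      simp only [edgeCodes, List.mem_cons, List.not_mem_nil, or_false, or_self] at hx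
      exact Or.inr (hx ▸ Nat.zero_le _)
    | coe e =>
      rw [hb] at hx
      obtain ⟨h1, h2, h3⟩ := h.best_le e hb
      simp only [edgeCodes, List.mem_cons, List.not_mem_nil, or_false] at hx
      rcases hx with rfl | rfl | rfl | rfl
      · exact Or.inr (Nat.succ_le_succ (Nat.zero_le _))
      · exact Or.inl h1
      · exact Or.inr (h2.trans (Nat.le_succ _))
      · exact Or.inr (h3.trans (Nat.le_succ _))

/-- A state is encoded by `15` numbers: the clock, and `7` numbers for each of the two synchronous
states. -/
theorem length_encode_le {s X : ℕ} (hw : ∀ e ∈ N.graph.edgeSet, N.weight e < 2 ^ s)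
    (hX : (N.maxIdent + 1) ^ 2 ≤ X) {γ : V → Clocked PrimState}
    (hγ : SyncAlgorithm.Synchronized primSync N ((N.maxIdent + 1) ^ 2) γ) (v : V) :
    (primAlgorithm.encode (γ v)).length ≤ 15 * (2 * (s + X.size) + 1) := by
  have hlen : (clockedCodes (γ v)).length = 15 := by
    simp [clockedCodes, PrimState.length_codes]
  rw [← hlen]
  refine length_encodeList_le fun x hx => ?_
  have hx' : x < 2 ^ s ∨ x ≤ X := by
    have hM : N.maxIdent + 1 ≤ X := le_trans (by nlinarith) hX
    rw [clockedCodes, List.mem_cons, List.mem_append] at hx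
    rcases hx with rfl | hx | hx
    · exact Or.inr ((hγ.clock_le v).trans hX)
    · rw [hγ.cur_eq v] at hx
      exact ((stateBounded_primExec hw _ v).codes_le x hx).imp id fun h => h.trans hM
    · rw [hγ.prev_eq v] at hx
      exact ((stateBounded_primExec hw _ v).codes_le x hx).imp id fun h => h.trans hM
  rcases hx' with h | h
  · exact (Nat.size_le.2 h).trans (Nat.le_add_right _ _)
  · exact (Nat.size_le_size h).trans (Nat.le_add_left _ _)

end Network

/-! ### The algorithm builds a minimum spanning tree -/

theorem Polynomial.eval_le_eval_one_mul_pow (q : ℕ[X]) {n : ℕ} (hn : 1 ≤ n) :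
    q.eval n ≤ q.eval 1 * n ^ q.natDegree := by
  rw [eval_eq_sum_range, eval_eq_sum_range, Finset.sum_mul]
  refine Finset.sum_le_sum fun i hi => ?_
  rw [one_pow, mul_one]
  exact Nat.mul_le_mul_left _ (Nat.pow_le_pow_right hn (Nat.lt_succ_iff.1 (Finset.mem_range.1 hi)))

theorem Nat.size_le_logb_add_one {x : ℕ} (hx : 1 ≤ x) : (x.size : ℝ) ≤ Real.logb 2 x + 1 := by
  obtain ⟨k, hk⟩ : ∃ k, x.size = k + 1 := ⟨x.size - 1, by have := Nat.size_pos.2 hx; lia⟩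
  have h : 2 ^ k ≤ x := Nat.lt_size.1 (by lia)
  rw [hk, Nat.cast_succ]
  refine add_le_add_left ((Real.le_logb_iff_rpow_le one_lt_two (by exact_mod_cast hx)).2 ?_) 1
  rw [Real.rpow_natCast]
  exact_mod_cast h

/-- There is a single distributed algorithm for the state model such that, for every polynomial
range `[1, p(n)]` of identifiers and weights, there are a constant `C` and a polynomial `q` such
that, on every network with `n` nodes and weights encoded on `s` bits, and against the distributed
unfair scheduler, every execution from the clean configuration terminates, uses at most
`C (s + log n)` bits per node in all its configurations, takes at most `q(n)` rounds, and ends with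
a minimum spanning tree. -/
theorem mainTheorem4 :
    ∃ A : DistAlgorithm, ∀ p : ℕ[X], ∃ (C : ℝ) (q : ℕ[X]),
      ∀ (V : Type*) [Fintype V] (N : Network V) (s : ℕ),
        0 < s →
        (∀ v, 1 ≤ N.ident v ∧ N.ident v ≤ p.eval (Fintype.card V)) →
        (∀ e ∈ N.graph.edgeSet,
          1 ≤ N.weight e ∧ N.weight e ≤ p.eval (Fintype.card V) ∧ N.weight e < 2 ^ s) →
        A.AlwaysTerminates N ∧
        ∀ (r : ℕ) (P : Set V) (γ : A.Config V), A.Run N r P γ →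
          (∀ v, ((A.encode (γ v)).length : ℝ) ≤ C * (s + Real.logb 2 (Fintype.card V))) ∧
          r ≤ q.eval (Fintype.card V) ∧
          (A.Terminal N γ → N.IsMST (A.outputGraph N γ)) := by
  refine ⟨primAlgorithm, fun p => ?_⟩
  set q : ℕ[X] := (p + 1) ^ 2 with hq
  refine ⟨15 * (5 + 2 * Real.logb 2 (q.eval 1 : ℕ) + 2 * q.natDegree), q, ?_⟩
  intro V _ N s hs hid hw
  have hid1 : ∀ v, 1 ≤ N.ident v := fun v => (hid v).1
  have hT : ∀ t ≤ (N.maxIdent + 1) ^ 2, ∀ v,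
      primSync.running t (primSync.exec N t v) ↔ t < (N.maxIdent + 1) ^ 2 :=
    fun t _ v => Network.primSync_running_iff hid1 t v
  refine ⟨SyncAlgorithm.alwaysTerminates hT, fun r P γ hrun => ?_⟩
  have hinv := SyncAlgorithm.roundInvariant_of_run hT hrun
  have hTq : (N.maxIdent + 1) ^ 2 ≤ q.eval (Fintype.card V) := by
    rw [hq, eval_pow, eval_add, eval_one]
    exact Nat.pow_le_pow_left (Nat.succ_le_succ (Finset.sup_le fun v _ => (hid v).2)) 2
  refine ⟨fun v => ?_, hinv.round_le.trans hTq, fun hterm => ?_⟩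
  · have hn : 1 ≤ Fintype.card V := Fintype.card_pos_iff.2 ⟨v⟩
    have hK : 1 ≤ q.eval 1 := by
      rw [hq, eval_pow, eval_add, eval_one]
      exact Nat.one_le_pow _ _ (Nat.succ_pos _)
    have hlen := Network.length_encode_le (fun e he => (hw e he).2.2) hTq hinv.toSynchronized v
    have hpos : 1 ≤ q.eval (Fintype.card V) := le_trans (Nat.one_le_pow _ _ (Nat.succ_pos _)) hTq
    have hsize := Nat.size_le_logb_add_one hpos
    have hlog : Real.logb 2 (q.eval (Fintype.card V) : ℕ) ≤
        Real.logb 2 (q.eval 1 : ℕ) + q.natDegree * Real.logb 2 (Fintype.card V) := by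
      have hn0 : (0 : ℝ) < Fintype.card V := by exact_mod_cast hn
      have hK0 : (0 : ℝ) < (q.eval 1 : ℕ) := by exact_mod_cast hK
      rw [← Real.logb_pow, ← Real.logb_mul hK0.ne' (pow_pos hn0 _).ne']
      refine Real.logb_le_logb_of_le one_lt_two (by exact_mod_cast hpos) ?_
      exact_mod_cast q.eval_le_eval_one_mul_pow hn
    have hl : 0 ≤ Real.logb 2 (Fintype.card V) :=
      Real.logb_nonneg one_lt_two (by exact_mod_cast hn)
    have hLK : 0 ≤ Real.logb 2 (q.eval 1 : ℕ) :=
      Real.logb_nonneg one_lt_two (by exact_mod_cast hK)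
    have hs1 : (1 : ℝ) ≤ s := by exact_mod_cast hs
    have hlen' : ((primAlgorithm.encode (γ v)).length : ℝ) ≤
        15 * (2 * (s + ((q.eval (Fintype.card V)).size : ℝ)) + 1) := by exact_mod_cast hlen
    set l := Real.logb 2 (Fintype.card V)
    set K := Real.logb 2 (q.eval 1 : ℕ)
    have hd : (0 : ℝ) ≤ q.natDegree := Nat.cast_nonneg _
    -- as `1 ≤ s`, the constants are absorbed by multiples of `s`
    nlinarith [mul_nonneg hLK (sub_nonneg.2 hs1), mul_nonneg hLK hl,
      mul_nonneg hd (by linarith : (0 : ℝ) ≤ s)]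
  · have hclock := hinv.toSynchronized.clock_eq_of_terminal hT hterm
    have hout : primAlgorithm.outputGraph N γ =
        N.pointerGraph fun v => (N.primExec ((N.maxIdent + 1) ^ 2) v).pointer := by
      have hptr : ∀ v, primAlgorithm.pointer (γ v) =
          (N.primExec ((N.maxIdent + 1) ^ 2) v).pointer := fun v => by
        rw [← hclock v]
        exact congrArg PrimState.pointer (hinv.cur_eq v)
      simp only [DistAlgorithm.outputGraph, Network.pointerGraph, hptr]
    rw [hout]
    exact Network.isMST_primExec hid1
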